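/- **Setting.** All categories are preadditive and all functors are additive. Let $\mathcal U$ be a small preadditive category (a ring with several objects), let $\mathrm{Mod}(\mathcal U)$ be the category of (right) $\mathcal U$-modules, i.e. of additive functors $\mathcal U^{\mathrm{op}}\to\mathrm{Ab}$, let $\mathcal C$ be a cocomplete abelian category satisfying AB5, and let $T:\mathcal U\to\mathcal C$ be an additive functor. Let $T_*:\mathcal C\to\mathrm{Mod}(\mathcal U)$, $T_*C=\mathcal C(T-,C)$, be the restriction functor and let $T^*:\mathrm{Mod}(\mathcal U)\to\mathcal C$ be its left adjoint, i.e. the colimit preserving functor, unique up to isomorphism, with $T^*\,\mathcal U(-,U)\cong TU$ naturally in $U\in\mathcal U$. We say that $T$ *induces a localization* if $(T^*,T_*)$ is an abelian localization, i.e. $T^*$ is exact and $T_*$ is fully faithful, and that $T$ is a *generalized lax epimorphism* if $T_*$ is fully faithful. **Proposition 4.1.** Consider the following conditions. * **(G)** The objects $T(U)$, $U\in\mathcal U$, generate $\mathcal C$: if $f,g:X\to Y$ in $\mathcal C$ satisfy $fh=gh$ for all $U\in\mathcal U$ and all $h:T(U)\to X$, then $f=g$. * **(F)** For all $U,U'\in\mathcal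 U$ and every map $\gamma:T(U)\to T(U')$ in $\mathcal C$ there are a set $J$, objects $V_j\in\mathcal U$ and maps $u_j:V_j\to U$, $u'_j:V_j\to U'$ in $\mathcal U$ ($j\in J$) such that $\gamma\,T(u_j)=T(u'_j)$ for all $j\in J$ and the sequence $$\bigoplus_{j\in J}T(V_j)\xrightarrow{(T(u_j))_j}T(U)\to 0$$ is exact in $\mathcal C$. If (G) holds, then $\mathcal C$ is a Grothendieck category. Moreover: * **(a)** If $T$ induces a localization, then (G) and (F) hold. * **(b)** If (G) and (F) hold, then $T$ is a generalized lax epimorphism. -/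

import Mathlib

open CategoryTheory CategoryTheory.Limits Opposite

universe v u

namespace GenLaxEpi

noncomputable section

/-- The category `Mod(U)` of (right) modules over a ring with several objects `U`, i.e. over a
small preadditive category: additive functors `Uᵒᵖ ⥤ Ab` and natural transformations. -/
abbrev ModCat (U : Type v) [SmallCategory U] [Preadditive U] : Type (v + 1) :=
  Uᵒᵖ ⥤+ AddCommGrpCat.{v}

/-- The representable module `U(-, X)`. -/
abbrev representable {U : Type v} [SmallCategory U] [Preadditive U] (X : U) : ModCat U :=
  ⟨preadditiveYoneda.obj X, inferInstanceAs (preadditiveYoneda.obj X).Additive⟩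

variable {U : Type v} [SmallCategory U] [Preadditive U]
variable {C : Type u} [Category.{v} C] [Abelian C]

/-- The restriction functor `T_* : C ⥤ Mod(U)`, `T_* A = C(T -, A)`, of an additive functor
`T : U ⥤ C`. -/
def restriction (T : U ⥤ C) [T.Additive] : C ⥤ ModCat U :=
  ObjectProperty.lift _
    (preadditiveYoneda ⋙ (Functor.whiskeringLeft Uᵒᵖ Cᵒᵖ AddCommGrpCat.{v}).obj T.op)
    (fun A => inferInstanceAs (T.op ⋙ preadditiveYoneda.obj A).Additive)

section Eval

variable {T : U ⥤ C} [T.Additive] {X : ModCat U}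

/-- For a module map `φ : X ⟶ T_* A`, the map `T W ⟶ A` which is the value of `φ` at `x` in
`X(W)`. -/
def evalHom {A : C} (φ : X ⟶ (restriction T).obj A) {W : U} (x : X.obj.obj (op W)) :
    T.obj W ⟶ A :=
  φ.hom.app (op W) x

lemma evalHom_map {A : C} (φ : X ⟶ (restriction T).obj A) {V W : U} (f : V ⟶ W)
    (x : X.obj.obj (op W)) : evalHom φ (X.obj.map f.op x) = T.map f ≫ evalHom φ x :=
  ConcreteCategory.congr_hom (φ.hom.naturality f.op) x

lemma evalHom_add {A : C} (φ : X ⟶ (restriction T).obj A) {W : U}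
    (x y : X.obj.obj (op W)) : evalHom φ (x + y) = evalHom φ x + evalHom φ y :=
  map_add (φ.hom.app (op W)).hom x y

lemma evalHom_comp {A B : C} (φ : X ⟶ (restriction T).obj A) (g : A ⟶ B) {W : U}
    (x : X.obj.obj (op W)) : evalHom (φ ≫ (restriction T).map g) x = evalHom φ x ≫ g :=
  rfl

lemma restriction_hom_ext {A : C} {φ ψ : X ⟶ (restriction T).obj A}
    (h : ∀ (W : U) (x : X.obj.obj (op W)), evalHom φ x = evalHom ψ x) : φ = ψ := by
  refine ObjectProperty.hom_ext _ (NatTrans.ext (funext fun W => ?_))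
  ext x
  exact h W.unop x

end Eval

section Induction

variable [HasColimits C] (T : U ⥤ C) (X : ModCat U)

/-- The coproduct of the objects `T W`, over all `W` in `U` and all `x` in `X(W)`. -/
abbrev genObj : C := ∐ fun p : (Σ W : U, X.obj.obj (op W)) => T.obj p.1

/-- The inclusion of the copy of `T W` indexed by `x` in `X(W)`. -/
abbrev gen {W : U} (x : X.obj.obj (op W)) : T.obj W ⟶ genObj T X :=
  Sigma.ι (fun p : (Σ W : U, X.obj.obj (op W)) => T.obj p.1) ⟨W, x⟩

/-- The functoriality relations: for `f : V ⟶ W` in `U` and `x` in `X(W)`, the copy of `T V`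
indexed by `X(f)(x)` is identified with its image under `T f` in the copy of `T W`
indexed by `x`. -/
abbrev relMap : (∐ fun p : (Σ W V : U, (V ⟶ W) × X.obj.obj (op W)) => T.obj p.2.1) ⟶ genObj T X :=
  Sigma.desc fun p => gen T X (X.obj.map p.2.2.1.op p.2.2.2) - T.map p.2.2.1 ≫ gen T X p.2.2.2

/-- The additivity relations, for `x` and `y` in `X(W)`. -/
abbrev relAdd : (∐ fun p : (Σ W : U, X.obj.obj (op W) × X.obj.obj (op W)) => T.obj p.1) ⟶
    genObj T X :=
  Sigma.desc fun p => gen T X (p.2.1 + p.2.2) - gen T X p.2.1 - gen T X p.2.2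

/-- The object `T^* X`, i.e. the tensor product `X ⊗_U T`: the quotient of the coproduct of the
objects `T W`, over all `W` in `U` and `x` in `X(W)`, by functoriality and additivity. -/
def inductionObj : C := cokernel (coprod.desc (relMap T X) (relAdd T X))

/-- The structure map `T W ⟶ T^* X` given by `x` in `X(W)`. -/
def inductionι {W : U} (x : X.obj.obj (op W)) : T.obj W ⟶ inductionObj T X :=
  gen T X x ≫ cokernel.π _

lemma inductionι_map {V W : U} (f : V ⟶ W) (x : X.obj.obj (op W)) :
    inductionι T X (X.obj.map f.op x) = T.map f ≫ inductionι T X x := by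
  have h := coprod.inl ≫= cokernel.condition (coprod.desc (relMap T X) (relAdd T X))
  have h' := Sigma.ι (fun p : (Σ W V : U, (V ⟶ W) × X.obj.obj (op W)) => T.obj p.2.1)
    ⟨W, V, f, x⟩ ≫= h
  simp only [coprod.inl_desc_assoc, Sigma.ι_desc_assoc, comp_zero, Preadditive.sub_comp,
    Category.assoc] at h'
  exact sub_eq_zero.1 h'

lemma inductionι_add {W : U} (x y : X.obj.obj (op W)) :
    inductionι T X (x + y) = inductionι T X x + inductionι T X y := by
  have h := coprod.inr ≫= cokernel.condition (coprod.desc (relMap T X) (relAdd T X))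
  have h' := Sigma.ι (fun p : (Σ W : U, X.obj.obj (op W) × X.obj.obj (op W)) => T.obj p.1)
    ⟨W, x, y⟩ ≫= h
  simp only [coprod.inr_desc_assoc, Sigma.ι_desc_assoc, comp_zero, Preadditive.sub_comp] at h'
  rw [sub_sub, sub_eq_zero] at h'
  exact h'

variable {T X}

lemma induction_hom_ext {A : C} {f g : inductionObj T X ⟶ A}
    (h : ∀ (W : U) (x : X.obj.obj (op W)), inductionι T X x ≫ f = inductionι T X x ≫ g) :
    f = g := by
  refine (cancel_epi (cokernel.π (coprod.desc (relMap T X) (relAdd T X)))).1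
    (Sigma.hom_ext _ _ ?_)
  rintro ⟨W, x⟩
  exact (Category.assoc _ _ _).symm.trans ((h W x).trans (Category.assoc _ _ _))

variable [T.Additive]

/-- The map `T^* X ⟶ A` corresponding to a module map `X ⟶ T_* A`. -/
def inductionDesc {A : C} (φ : X ⟶ (restriction T).obj A) : inductionObj T X ⟶ A :=
  cokernel.desc _
    (Sigma.desc fun p : (Σ W : U, X.obj.obj (op W)) => evalHom φ p.2)
    (by
      apply coprod.hom_ext
      · refine Sigma.hom_ext _ _ ?_
        rintro ⟨W, V, f, x⟩
        rw [coprod.inl_desc_assoc, Sigma.ι_desc_assoc, Preadditive.sub_comp, Category.assoc,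
          Sigma.ι_desc, Sigma.ι_desc, evalHom_map, sub_self, comp_zero, comp_zero]
      · refine Sigma.hom_ext _ _ ?_
        rintro ⟨W, x, y⟩
        rw [coprod.inr_desc_assoc, Sigma.ι_desc_assoc, Preadditive.sub_comp, Preadditive.sub_comp,
          Sigma.ι_desc, Sigma.ι_desc, Sigma.ι_desc, evalHom_add, sub_sub, sub_self, comp_zero,
          comp_zero])

lemma inductionι_desc {A : C} (φ : X ⟶ (restriction T).obj A) {W : U} (x : X.obj.obj (op W)) :
    inductionι T X x ≫ inductionDesc φ = evalHom φ x :=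
  (Category.assoc _ _ _).trans ((gen T X x ≫= cokernel.π_desc _ _ _).trans (Sigma.ι_desc _ _))

/-- The module map `X ⟶ T_* A` corresponding to a map `T^* X ⟶ A`. -/
def inductionLift {A : C} (f : inductionObj T X ⟶ A) : X ⟶ (restriction T).obj A :=
  ObjectProperty.homMk
    { app := fun W => AddCommGrpCat.ofHom
        (AddMonoidHom.mk'
          (fun x : X.obj.obj (op W.unop) => (inductionι T X x ≫ f : T.obj W.unop ⟶ A))
          (fun x y => by rw [inductionι_add, Preadditive.add_comp]; rfl))
      naturality := fun W V g => by
        ext x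
        exact (congrArg (· ≫ f) (inductionι_map T X g.unop x)).trans (Category.assoc _ _ _) }

lemma evalHom_inductionLift {A : C} (f : inductionObj T X ⟶ A) {W : U} (x : X.obj.obj (op W)) :
    evalHom (inductionLift f) x = inductionι T X x ≫ f :=
  rfl

variable (T X) in
/-- The bijection `C(T^* X, A) ≃ Hom(X, T_* A)`. -/
def inductionHomEquiv (A : C) : (inductionObj T X ⟶ A) ≃ (X ⟶ (restriction T).obj A) where
  toFun := inductionLift
  invFun := inductionDesc
  left_inv f := induction_hom_ext fun W x => by rw [inductionι_desc, evalHom_inductionLift]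
  right_inv φ := restriction_hom_ext fun W x => by rw [evalHom_inductionLift, inductionι_desc]

/-- The module map `U(-, W) ⟶ T_* (T W)` given by the action of `T` on maps. -/
def representableUnit (T : U ⥤ C) [T.Additive] (W : U) :
    representable W ⟶ (restriction T).obj (T.obj W) :=
  ObjectProperty.homMk
    { app := fun V => AddCommGrpCat.ofHom (T.mapAddHom : (V.unop ⟶ W) →+ _)
      naturality := fun V V' f => by
        ext g
        exact T.map_comp f.unop g }

/-- On representable modules, `T^*` agrees with `T`: `T^* U(-, W) ≅ T W`. -/
def inductionRepresentableIso (T : U ⥤ C) [T.Additive] (W : U) :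
    inductionObj T (representable W) ≅ T.obj W where
  hom := inductionDesc (representableUnit T W)
  inv := inductionι T (representable W) (𝟙 W)
  hom_inv_id := induction_hom_ext fun V f => by
    refine (Category.assoc _ _ _).symm.trans ?_
    rw [inductionι_desc, Category.comp_id]
    refine (inductionι_map T (representable W) (W := W) f (𝟙 W)).symm.trans ?_
    exact congrArg (inductionι T (representable W)) (Category.comp_id f)
  inv_hom_id := (inductionι_desc _ _).trans (T.map_id W)

end Induction

section

variable [HasColimits C] (T : U ⥤ C) [T.Additive]

lemma inductionHomEquiv_naturality (X : ModCat U) (A B : C) (g : A ⟶ B)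
    (f : inductionObj T X ⟶ A) : inductionHomEquiv T X B (f ≫ g) =
      inductionHomEquiv T X A f ≫ (restriction T).map g :=
  restriction_hom_ext fun _ _ => (Category.assoc _ _ _).symm

/-- The induction functor `T^* : Mod(U) ⥤ C` of an additive functor `T : U ⥤ C`: the unique (up
to isomorphism) colimit preserving functor which extends `T` along the Yoneda embedding. -/
def induction : ModCat U ⥤ C :=
  Adjunction.leftAdjointOfEquiv (fun X A => inductionHomEquiv T X A)
    (inductionHomEquiv_naturality T)

/-- The adjoint pair `(T^*, T_*)` induced by `T`. -/
def inducedAdjunction : induction T ⊣ restriction T :=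
  Adjunction.adjunctionOfEquivLeft (fun X A => inductionHomEquiv T X A)
    (inductionHomEquiv_naturality T)

end

/-- An abelian localization: an adjoint pair of functors (between abelian categories) whose left
adjoint is exact and whose right adjoint is fully faithful. -/
structure IsAbelianLocalization {A : Type*} [Category* A] {B : Type*} [Category* B]
    {L : A ⥤ B} {R : B ⥤ A} (_adj : L ⊣ R) : Prop where
  preservesFiniteLimits : PreservesFiniteLimits L
  preservesFiniteColimits : PreservesFiniteColimits L
  full : R.Full
  faithful : R.Faithful

variable (T : U ⥤ C)

/-- `T` induces a localization: the adjoint pair `(T^*, T_*)` is an abelian localization. -/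
def InducesLocalization [HasColimits C] [T.Additive] : Prop :=
  IsAbelianLocalization (inducedAdjunction T)

/-- `T` is a generalized lax epimorphism: the restriction functor `T_*` is fully faithful. -/
structure IsGeneralizedLaxEpi [T.Additive] : Prop where
  full : (restriction T).Full
  faithful : (restriction T).Faithful

/-- Condition (G): the objects `T W`, for `W` in `U`, generate `C`. -/
def ConditionG : Prop := (ObjectProperty.ofObj T.obj).IsSeparating

/-- Condition (F): every `γ : T W ⟶ T W'` is a fraction of maps coming from `U`, along an
epimorphic family. -/
def ConditionF [HasColimits C] : Prop :=
  ∀ ⦃W W' : U⦄ (γ : T.obj W ⟶ T.obj W'),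
    ∃ (J : Type v) (V : J → U) (u : ∀ j, V j ⟶ W) (u' : ∀ j, V j ⟶ W'),
      (∀ j, T.map (u j) ≫ γ = T.map (u' j)) ∧ Epi (Sigma.desc fun j => T.map (u j))

end

end GenLaxEpi

/-! If `T` induces a localization, (G) is faithfulness of `T_*`. For (F), `T^*` inverts each unit
`U(-, W') ⟶ T_* (T W')`. Being exact, `T^*` also inverts the pullback of such a unit along a map
induced by `γ`. That pullback is the module of fractions of `γ`, whose elements give the required
epimorphic family (`fractions_isPullback`).

Conversely, (G) gives faithfulness and presents `A` as a quotient of the coproduct of `T W` over all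
`x : T W ⟶ A`. A module map `φ : T_* A ⟶ T_* B` sends each `x` to `φ x`, and fullness means that
this assignment kills the kernel. AB5 and (G) reduce this to finite relations `∑ γ i ≫ x i = 0` with
`γ i` between objects of the form `T W`. By (F) the `γ i` locally become maps coming from `U`, for
which `φ` is natural. -/

namespace GenLaxEpi

noncomputable section

variable {U : Type v} [SmallCategory U] [Preadditive U]
variable {C : Type u} [Category.{v} C] [Abelian C]

/-! ### Localizations satisfy (G) and (F). -/

section Localization

/-- The module of common fractions of `γ : T W ⟶ T W'`: its value at `V` consists of the pairs
`(u, u')` of maps `V ⟶ W` and `V ⟶ W'` with `T u ≫ γ = T u'`. -/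
def fractions (T : U ⥤ C) [T.Additive] {W W' : U} (γ : T.obj W ⟶ T.obj W') : ModCat U where
  obj :=
    { obj := fun V => AddCommGrpCat.of
        ({ carrier := {p : (V.unop ⟶ W) × (V.unop ⟶ W') | T.map p.1 ≫ γ = T.map p.2}
           add_mem' := fun {p q} hp hq => by
            simp only [Set.mem_ofPred_eq] at hp hq ⊢
            simp [hp, hq]
           zero_mem' := by simp
           neg_mem' := fun {p} hp => by
            simp only [Set.mem_ofPred_eq] at hp ⊢
            simp [hp] } : AddSubgroup ((V.unop ⟶ W) × (V.unop ⟶ W')))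
      map := fun {V V'} f => AddCommGrpCat.ofHom (AddMonoidHom.mk'
        (fun p => ⟨(f.unop ≫ p.1.1, f.unop ≫ p.1.2), by
          have h : T.map p.1.1 ≫ γ = T.map p.1.2 := p.2
          change T.map (f.unop ≫ p.1.1) ≫ γ = T.map (f.unop ≫ p.1.2)
          rw [T.map_comp, T.map_comp, Category.assoc, h]⟩)
        (fun p q => Subtype.ext (Prod.ext (Preadditive.comp_add _ _ _ _ _ _)
          (Preadditive.comp_add _ _ _ _ _ _))))
      map_id := fun V => by
        refine ConcreteCategory.hom_ext _ _ fun p => ?_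
        exact Subtype.ext (Prod.ext (Category.id_comp p.1.1) (Category.id_comp p.1.2))
      map_comp := fun f g => by
        refine ConcreteCategory.hom_ext _ _ fun p => ?_
        exact Subtype.ext (Prod.ext (Category.assoc g.unop f.unop p.1.1)
          (Category.assoc g.unop f.unop p.1.2)) }
  property := ⟨fun {V V' f g} => by
    refine ConcreteCategory.hom_ext _ _ fun p => ?_
    exact Subtype.ext (Prod.ext (Preadditive.add_comp _ _ _ f.unop g.unop p.1.1)
      (Preadditive.add_comp _ _ _ f.unop g.unop p.1.2))⟩

variable (T : U ⥤ C) [T.Additive] {W W' : U} (γ : T.obj W ⟶ T.obj W')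

/-- The denominator of a fraction. -/
def fractionsFst : fractions T γ ⟶ representable W :=
  ObjectProperty.homMk
    { app := fun _ => AddCommGrpCat.ofHom (AddMonoidHom.mk' (fun p => p.1.1) fun _ _ => rfl)
      naturality := fun _ _ _ => rfl }

/-- The numerator of a fraction. -/
def fractionsSnd : fractions T γ ⟶ representable W' :=
  ObjectProperty.homMk
    { app := fun _ => AddCommGrpCat.ofHom (AddMonoidHom.mk' (fun p => p.1.2) fun _ _ => rfl)
      naturality := fun _ _ _ => rfl }

lemma fractions_isPullback : IsPullback (fractionsFst T γ) (fractionsSnd T γ)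
    (representableUnit T W ≫ (restriction T).map γ) (representableUnit T W') where
  w := restriction_hom_ext fun _ x => x.2
  isLimit' := ⟨PullbackCone.IsLimit.mk _
    (fun s => ObjectProperty.homMk
      { app := fun V => AddCommGrpCat.ofHom (AddMonoidHom.mk'
          (fun x => ⟨(s.fst.hom.app V x, s.snd.hom.app V x),
            congrArg (fun φ => evalHom φ (W := V.unop) x) s.condition⟩)
          (fun x y => Subtype.ext (Prod.ext (map_add (s.fst.hom.app V).hom x y)
            (map_add (s.snd.hom.app V).hom x y))))
        naturality := fun V V' f => by
          ext x
          exact Subtype.ext (Prod.ext (ConcreteCategory.congr_hom (s.fst.hom.naturality f) x)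
            (ConcreteCategory.congr_hom (s.snd.hom.naturality f) x)) })
    (fun s => rfl) (fun s => rfl)
    (fun s m h₁ h₂ => by
      refine ObjectProperty.hom_ext _ (NatTrans.ext (funext fun V => ?_))
      ext x
      exact Subtype.ext (Prod.ext
        (ConcreteCategory.congr_hom (congrArg (fun φ => φ.hom.app V) h₁) x)
        (ConcreteCategory.congr_hom (congrArg (fun φ => φ.hom.app V) h₂) x)))⟩

variable [HasColimits C]

lemma inducedAdjunction_homEquiv (X : ModCat U) (A : C) :
    (inducedAdjunction T).homEquiv X A = inductionHomEquiv T X A :=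
  congrFun (congrFun (Adjunction.mkOfHomEquiv_homEquiv _) X) A

lemma induction_map_comp_counit {X : ModCat U} {A : C} (φ : X ⟶ (restriction T).obj A) :
    (induction T).map φ ≫ (inducedAdjunction T).counit.app A = inductionDesc φ :=
  ((inducedAdjunction T).homEquiv_counit (X := X) (Y := A) (g := φ)).symm.trans
    (congrArg (fun e => e.symm φ) (inducedAdjunction_homEquiv T X A))

lemma induction_map_comp_desc {X Y : ModCat U} {A : C} (f : X ⟶ Y)
    (φ : Y ⟶ (restriction T).obj A) :
    (induction T).map f ≫ inductionDesc φ = inductionDesc (f ≫ φ) := by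
  have h := (inducedAdjunction T).homEquiv_naturality_left_symm f φ
  rw [inducedAdjunction_homEquiv, inducedAdjunction_homEquiv] at h
  exact h.symm

instance isIso_inductionDesc_representableUnit (W : U) :
    IsIso (inductionDesc (representableUnit T W)) :=
  (inductionRepresentableIso T W).isIso_hom

variable {T}

lemma InducesLocalization.conditionG (h : InducesLocalization T) : ConditionG T := by
  have := h.faithful
  intro X Y f g hfg
  refine (restriction T).map_injective (restriction_hom_ext fun W x => ?_)
  exact hfg _ (ObjectProperty.ofObj_apply T.obj W) x

lemma InducesLocalization.conditionF (h : InducesLocalization T) : ConditionF T := by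
  intro W W' γ
  have := h.full
  have := h.faithful
  have := h.preservesFiniteLimits
  have : IsIso ((induction T).map (representableUnit T W')) := by
    have e := induction_map_comp_counit T (representableUnit T W')
    have : IsIso ((induction T).map (representableUnit T W') ≫
        (inducedAdjunction T).counit.app (T.obj W')) :=
      e ▸ isIso_inductionDesc_representableUnit T W'
    -- The counit is invertible because `T_*` is fully faithful.
    exact IsIso.of_isIso_comp_right _ ((inducedAdjunction T).counit.app (T.obj W'))
  have : IsIso ((induction T).map (fractionsFst T γ)) :=
    ((fractions_isPullback T γ).map (induction T)).isIso_fst_of_isIso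
  -- The family consists of all fractions of `γ`; it is small because `U` is.
  refine ⟨Σ V : U, (fractions T γ).obj.obj (op V), fun p => p.1, fun p => p.2.1.1,
    fun p => p.2.1.2, fun p => p.2.2, ⟨fun {Q} f g hfg => ?_⟩⟩
  have hfg' (V : U) (x : (fractions T γ).obj.obj (op V)) : T.map x.1.1 ≫ f = T.map x.1.1 ≫ g := by
    have := Sigma.ι (fun p : Σ V : U, (fractions T γ).obj.obj (op V) => T.obj p.1) ⟨V, x⟩ ≫= hfg
    simpa using this
  have : IsIso ((induction T).map (fractionsFst T γ) ≫ inductionDesc (representableUnit T W)) :=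
    IsIso.comp_isIso' ‹_› (isIso_inductionDesc_representableUnit T W)
  have : IsIso (inductionDesc (fractionsFst T γ ≫ representableUnit T W)) :=
    induction_map_comp_desc T (fractionsFst T γ) (representableUnit T W) ▸ this
  -- This isomorphism from `T^*` of the fractions to `T W` restricts to `T.map u` along the
  -- structure map of a fraction `(u, u')`, so the maps `T.map u` are jointly epimorphic.
  refine (cancel_epi (inductionDesc (fractionsFst T γ ≫ representableUnit T W))).1
    (induction_hom_ext fun V x => ?_)
  rw [← Category.assoc, ← Category.assoc, inductionι_desc]
  exact hfg' V x

end Localization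

-- Reduction to finite coproducts by AB5.

attribute [local instance] IsFiltered.isConnected in
open CoproductsFromFiniteFiltered in
/-- In an AB5 category, the vanishing of a composition through a coproduct can be tested after
composition with the maps which factor through a finite subcoproduct. -/
lemma comp_eq_zero_of_finite_sums [HasColimits C] [AB5 C] {α : Type v} (f : α → C) {X Y : C}
    (g : X ⟶ ∐ f) (h : ∐ f ⟶ Y)
    (H : ∀ {Z : C} (m : Z ⟶ X) {κ : Type v} (s : Finset κ) (i : κ → α) (γ : ∀ a, Z ⟶ f (i a)),
      m ≫ g = ∑ a ∈ s, γ a ≫ Sigma.ι f (i a) → m ≫ g ≫ h = 0) : g ≫ h = 0 := by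
  classical
  -- By AB5, the pullbacks of the finite subcoproducts along `g` jointly cover `X`.
  refine (isColimitFiniteSubproductsCocone f).pullback_zero_ext fun F => ?_
  have key (P : C) (k : P ⟶ ∐ fun x : F => f x.1.as) :
      k ≫ (finiteSubcoproductsCocone f).ι.app F =
        ∑ a ∈ F.attach, (k ≫ Sigma.π (fun x : F => f x.1.as) a) ≫ Sigma.ι f a.1.as := by
    refine (k ≫= finiteSubcoproductsCocone_ι_app_eq_sum f F).trans
      ((Preadditive.comp_sum _ _ _).trans (Finset.sum_congr rfl fun a _ => ?_))
    exact (Category.assoc _ _ _).symm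
  exact H (pullback.snd ((finiteSubcoproductsCocone f).ι.app F) g) F.attach (fun a => a.1.as) _
    (pullback.condition.symm.trans (key _ (pullback.fst _ _)))

/-! ### (G) and (F) make `T_*` fully faithful. -/

section LaxEpi

variable {T : U ⥤ C}

omit [Preadditive U] in
lemma ConditionG.isGrothendieckAbelian [HasColimits C] [AB5 C] (hG : ConditionG T) :
    IsGrothendieckAbelian.{v} C where
  hasSeparator := ⟨_, ObjectProperty.IsSeparating.isSeparator_coproduct hG⟩

lemma ConditionG.faithful [T.Additive] (hG : ConditionG T) : (restriction T).Faithful where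
  map_injective {A B f g} hfg := by
    refine hG f g fun Z hZ x => ?_
    obtain ⟨W⟩ := hZ
    exact congrArg (fun φ => evalHom φ (W := W) x) hfg

omit [Preadditive U] in
/-- Finitely many maps out of `T W` can be written as fractions of maps coming from `U`
simultaneously, along a jointly epimorphic family. -/
lemma ConditionF.eq_zero_of_fractions [HasColimits C] (hF : ConditionF T) {ι : Type*}
    (s : Finset ι) {W : U} (Z : ι → U) (γ : ∀ i, T.obj W ⟶ T.obj (Z i)) {B : C} (h : T.obj W ⟶ B)
    (H : ∀ (V : U) (u : V ⟶ W), (∀ i ∈ s, ∃ u' : V ⟶ Z i, T.map u ≫ γ i = T.map u') →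
      T.map u ≫ h = 0) : h = 0 := by
  classical
  induction s using Finset.induction_on with
  | empty => simpa using H W (𝟙 W) (by simp)
  | insert a s _ ih =>
    refine ih fun V u hu => ?_
    -- Refining the cover along `v` turns `γ a` into a fraction and keeps the earlier ones, since
    -- fractions are stable under precomposition with maps of `U`.
    obtain ⟨J, V', v, v', hv, hepi⟩ := hF (T.map u ≫ γ a)
    refine (cancel_epi (Sigma.desc fun j => T.map (v j))).1 (Sigma.hom_ext _ _ fun j => ?_)
    have := H (V' j) (v j ≫ u) fun i hi => by
      obtain rfl | hi := Finset.mem_insert.1 hi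
      · exact ⟨v' j, by simpa using hv j⟩
      · obtain ⟨u', hu'⟩ := hu i hi
        exact ⟨v j ≫ u', by simp [hu']⟩
    simpa using this

lemma evalHom_sum [T.Additive] {X : ModCat U} {A : C} (φ : X ⟶ (restriction T).obj A) {W : U}
    {ι : Type*} (s : Finset ι) (x : ι → X.obj.obj (op W)) :
    evalHom φ (∑ i ∈ s, x i) = ∑ i ∈ s, evalHom φ (x i) :=
  map_sum (φ.hom.app (op W)).hom x s

lemma evalHom_restriction_comp [T.Additive] {A B : C}
    (φ : (restriction T).obj A ⟶ (restriction T).obj B) {V W : U} (f : V ⟶ W) (x : T.obj W ⟶ A) :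
    evalHom φ (W := V) (T.map f ≫ x : T.obj V ⟶ A) = T.map f ≫ evalHom φ (W := W) x :=
  evalHom_map φ f x

variable [T.Additive] [HasColimits C]

/-- The map from the coproduct of the `T W`, over all maps `x : T W ⟶ A`, to `B` which is
`φ x` on the summand of `x`. -/
def totalMap {A B : C} (φ : (restriction T).obj A ⟶ (restriction T).obj B) :
    (∐ fun p : (Σ W : U, T.obj W ⟶ A) => T.obj p.1) ⟶ B :=
  Sigma.desc fun p => evalHom φ (W := p.1) p.2

lemma ι_totalMap {A B : C} (φ : (restriction T).obj A ⟶ (restriction T).obj B)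
    (p : Σ W : U, T.obj W ⟶ A) :
    Sigma.ι (fun p : (Σ W : U, T.obj W ⟶ A) => T.obj p.1) p ≫ totalMap φ =
      evalHom φ (W := p.1) p.2 :=
  Sigma.ι_desc _ _

lemma ι_totalMap_assoc {A B D : C} (φ : (restriction T).obj A ⟶ (restriction T).obj B)
    (p : Σ W : U, T.obj W ⟶ A) (f : B ⟶ D) :
    Sigma.ι (fun p : (Σ W : U, T.obj W ⟶ A) => T.obj p.1) p ≫ totalMap φ ≫ f =
      evalHom φ (W := p.1) p.2 ≫ f := by
  rw [← Category.assoc, ι_totalMap]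

lemma ConditionG.epi_totalMap_id (hG : ConditionG T) (A : C) :
    Epi (totalMap (𝟙 ((restriction T).obj A))) where
  left_cancellation f g hfg := by
    refine hG f g fun Z hZ x => ?_
    obtain ⟨W⟩ := hZ
    have := Sigma.ι (fun p : (Σ W : U, T.obj W ⟶ A) => T.obj p.1) ⟨W, x⟩ ≫= hfg
    rw [ι_totalMap_assoc, ι_totalMap_assoc] at this
    exact this

/-- A relation between maps `x i : T (Z i) ⟶ A` with coefficients in `C` is preserved by a
module map `T_* A ⟶ T_* B`. -/
lemma ConditionF.sum_comp_evalHom_eq_zero (hF : ConditionF T) {A B : C}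
    (φ : (restriction T).obj A ⟶ (restriction T).obj B) {ι : Type*} (s : Finset ι) {W : U}
    (Z : ι → U) (γ : ∀ i, T.obj W ⟶ T.obj (Z i)) (x : ∀ i, T.obj (Z i) ⟶ A)
    (h : ∑ i ∈ s, γ i ≫ x i = 0) : ∑ i ∈ s, γ i ≫ evalHom φ (W := Z i) (x i) = 0 := by
  refine hF.eq_zero_of_fractions s Z γ _ fun V u hu => ?_
  choose! u' hu' using hu
  have key : evalHom φ (W := V) (∑ i ∈ s, T.map (u' i) ≫ x i : T.obj V ⟶ A) =
      ∑ i ∈ s, evalHom φ (W := V) (T.map (u' i) ≫ x i : T.obj V ⟶ A) :=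
    evalHom_sum φ s _
  have zero : (∑ i ∈ s, T.map (u' i) ≫ x i) = 0 := by
    rw [← comp_zero (f := T.map u), ← h, Preadditive.comp_sum]
    exact Finset.sum_congr rfl fun i hi => by rw [← hu' i hi, Category.assoc]
  rw [zero] at key
  rw [Preadditive.comp_sum, Finset.sum_congr rfl fun i hi => by
    rw [← Category.assoc, hu' i hi, ← evalHom_restriction_comp], ← key]
  exact map_zero (φ.hom.app (op V)).hom

/-- This is what lets `totalMap φ` descend to `A`, the quotient of the coproduct by this kernel. -/
lemma kernel_ι_totalMap_id_comp_totalMap [AB5 C] (hG : ConditionG T) (hF : ConditionF T)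
    {A B : C} (φ : (restriction T).obj A ⟶ (restriction T).obj B) :
    kernel.ι (totalMap (𝟙 ((restriction T).obj A))) ≫ totalMap φ = 0 := by
  refine comp_eq_zero_of_finite_sums _ _ _ fun {_} m {_} s i γ hγ => ?_
  refine hG _ _ fun Z hZ t => ?_
  obtain ⟨W⟩ := hZ
  -- Used twice: for `𝟙` the left side vanishes and yields the relation among the `x i`; for `φ` it
  -- is the sum to be killed.
  have comp_total {B : C} (φ : (restriction T).obj A ⟶ (restriction T).obj B) :
      t ≫ m ≫ kernel.ι (totalMap (𝟙 ((restriction T).obj A))) ≫ totalMap φ =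
        ∑ a ∈ s, (t ≫ γ a) ≫ evalHom φ (W := (i a).1) (i a).2 := by
    have := t ≫= hγ =≫ totalMap φ
    simpa only [Category.assoc, Preadditive.sum_comp, Preadditive.comp_sum, ι_totalMap] using this
  rw [comp_zero]
  refine (comp_total φ).trans (hF.sum_comp_evalHom_eq_zero φ s (fun a => (i a).1)
    (fun a => t ≫ γ a) (fun a => (i a).2) ((comp_total (𝟙 _)).symm.trans ?_))
  rw [kernel.condition, comp_zero, comp_zero]

lemma full_of_conditionG_of_conditionF [AB5 C] (hG : ConditionG T) (hF : ConditionF T) :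
    (restriction T).Full where
  map_surjective {A B} φ := by
    have := hG.epi_totalMap_id A
    have h := kernel_ι_totalMap_id_comp_totalMap hG hF φ
    refine ⟨Abelian.epiDesc _ _ h, restriction_hom_ext fun W x => ?_⟩
    have := Sigma.ι (fun p : (Σ W : U, T.obj W ⟶ A) => T.obj p.1) ⟨W, x⟩ ≫=
      Abelian.comp_epiDesc _ _ h
    rw [ι_totalMap_assoc, ι_totalMap] at this
    exact this

end LaxEpi

end

end GenLaxEpi

theorem proposition4p1 {U : Type v} [SmallCategory U] [Preadditive U]
    {C : Type u} [Category.{v} C] [Abelian C] [HasColimits C] [AB5 C]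
    (T : U ⥤ C) [T.Additive] :
    (GenLaxEpi.ConditionG T → IsGrothendieckAbelian.{v} C) ∧
    (GenLaxEpi.InducesLocalization T →
      GenLaxEpi.ConditionG T ∧ GenLaxEpi.ConditionF T) ∧
    (GenLaxEpi.ConditionG T ∧ GenLaxEpi.ConditionF T →
      GenLaxEpi.IsGeneralizedLaxEpi T) :=
  ⟨fun hG => hG.isGrothendieckAbelian, fun h => ⟨h.conditionG, h.conditionF⟩,
    fun ⟨hG, hF⟩ => ⟨GenLaxEpi.full_of_conditionG_of_conditionF hG hF, hG.faithful⟩⟩
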